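/- Let $G=(V,E)$ be a finite directed acyclic multigraph (nodes $V$, channels $E$, each of unit capacity) with a distinguished source node $s$ that has no incoming channels. For a node $v$ let $\mathrm{Out}(v)$ and $\mathrm{In}(v)$ be its sets of outgoing and incoming channels, except that $\mathrm{In}(s)=\{d_1',\dots,d_\omega'\}$ consists of $\omega\ge 1$ imaginary message channels. For a non-source node $t$ let $C_t$ be the minimum number of channels whose removal disconnects $s$ from $t$, and put $\delta_t=C_t-\omega$. Let $\mathcal F$ be a field. An $\omega$-dimensional $\mathcal F$-valued linear network error correction (LNEC) code on $G$ is a choice of local coefficients $k_{d,e}\in\mathcal F$ for all pairs $(d,e)$ with $e\in E$ and $d\in\mathrm{In}(\mathrm{tail}(e))$. Its extended global encoding kernels $\tilde f_e\in\mathcal F^{\mathrm{In}(s)\cup E}$ are the column vectors given by $\tilde f_{d_i'}=1_{d_i'}$ and $$\tilde f_e=\sum_{d\in\mathrm{In}(\mathrm{tail}(e))}k_{d,e}\tilde f_d+1_e\qquad(e\in E),$$ where $1_d$ is the indicator vector of $d$. For a non-source node $t$, let $\mathrm{row}_t(d)$, $d\in\mathrm{In}(s)\cup E$, be the rows of the decoding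 matrix $\tilde F_t=[\tilde f_e: e\in\mathrm{In}(t)]$. Define $$\Phi(t)=\langle \mathrm{row}_t(d_i'):1\le i\le\omega\rangle,\qquad \Delta(t,\rho)=\langle\mathrm{row}_t(e):e\in\rho\rangle$$ for an error pattern $\rho\subseteq E$. Write $\rho_1\prec_t\rho_2$ if $\Delta(t,\rho_1)\subseteq\Delta(t,\rho_2)$ for every $\omega$-dimensional $\mathcal F$-valued LNEC code on $G$, and put $\mathrm{rank}_t(\rho)=\min\{|\rho'|:\rho\prec_t\rho'\}$. For $C_t\ge\omega$ let $$R_t(\delta_t)=\{\rho\subseteq E:\ |\rho|=\mathrm{rank}_t(\rho)=\delta_t\}.$$ The minimum distance of a code at $t$ is $$d_{\min}^{(t)}=\min\{\mathrm{rank}_t(\rho):\ \Delta(t,\rho)\cap\Phi(t)\ne\{0\}\}.$$ The code is called regular if $\dim\Phi(t)=\omega$ for every non-source node $t$ with $C_t\ge\omega$. It is called an LNEC multicast MDS code if it is regular and $d_{\min}^{(t)}=\delta_t+1$ for every non-source node $t$ with $C_t\ge\omega$. Theorem. If $$|\mathcal F|>\sum_{t\in V\setminus\{s\}:\ C_t\ge\omega}|R_t(\delta_t)|,$$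 then there exists an $\omega$-dimensional $\mathcal F$-valued LNEC multicast MDS code on $G$. -/

import Mathlib

noncomputable section

namespace LNEC

/-- A single-source acyclic network with node set `V` and channel set `E`. Every channel has
unit capacity; parallel channels are allowed. The source has no incoming (real) channels. -/
structure Network (V E : Type*) where
  tail : E → V
  head : E → V
  source : V
  /-- there is no directed cycle -/
  acyclic : ∀ v : V, ¬ Relation.TransGen (fun i j => ∃ e, tail e = i ∧ head e = j) v v
  source_no_in : ∀ e : E, head e ≠ source

namespace Network

/-- The real incoming channels of a node. -/
abbrev InEdge {V E : Type*} (N : Network V E) (v : V) : Type _ := {e : E // N.head e = v}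

/-- The set `A` of channels is a cut between the source and `t`: after removing the channels of `A`
there is no directed path from the source to `t`. -/
def IsCut {V E : Type*} (N : Network V E) (t : V) (A : Finset E) : Prop :=
  ¬ Relation.ReflTransGen (fun i j => ∃ e, e ∉ A ∧ N.tail e = i ∧ N.head e = j) N.source t

/-- The minimum cut capacity `C_t` between the source and a non-source node `t`. -/
def minCut {V E : Type*} (N : Network V E) (t : V) : ℕ :=
  sInf {n | ∃ A : Finset E, N.IsCut t A ∧ A.card = n}

/-- For a non-source node the whole channel set is a cut, so `minCut` is a genuine minimum. -/
theorem isCut_univ {V E : Type*} [Fintype E] (N : Network V E) {t : V} (ht : t ≠ N.source) :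
    N.IsCut t Finset.univ := by
  intro h
  rcases Relation.ReflTransGen.cases_head h with h | ⟨_, ⟨e, he, _⟩, _⟩
  · exact ht h.symm
  · exact he (Finset.mem_univ e)

/-- The redundancy `δ_t = C_t - ω`; it is used only at nodes with `ω ≤ C_t`. -/
def redundancy {V E : Type*} (N : Network V E) (ω : ℕ) (t : V) : ℕ := N.minCut t - ω

open Classical in
/-- The non-source nodes `t` with `C_t ≥ ω`. -/
def decodingNodes {V E : Type*} [Fintype V] (N : Network V E) (ω : ℕ) : Finset V :=
  Finset.univ.filter fun t => t ≠ N.source ∧ ω ≤ N.minCut t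

/-- The head of a channel in `In(s) ∪ E`: the imaginary message channels `d_1', …, d_ω'`, indexed by
`Fin ω`, all enter the source. -/
def headExt {V E : Type*} (N : Network V E) (ω : ℕ) : Fin ω ⊕ E → V :=
  Sum.elim (fun _ => N.source) N.head

open Classical in
/-- The set `In(v)` of incoming channels, where `In(s)` consists of the imaginary message
channels. -/
def inChannels {V E : Type*} [Fintype E] (N : Network V E) (ω : ℕ) (v : V) :
    Finset (Fin ω ⊕ E) :=
  Finset.univ.filter fun d => N.headExt ω d = v

theorem mem_inChannels {V E : Type*} [Fintype E] (N : Network V E) (ω : ℕ) (v : V)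
    (d : Fin ω ⊕ E) : d ∈ N.inChannels ω v ↔ N.headExt ω d = v := by
  simp [inChannels]

/-- Since the network is finite and acyclic, one can recurse along the channels. -/
theorem wellFounded_adj {V E : Type*} [Fintype E] (N : Network V E) :
    WellFounded (fun d e : E => N.head d = N.tail e) := by
  have key : ∀ {d e : E}, Relation.TransGen (fun d e : E => N.head d = N.tail e) d e →
      Relation.TransGen (fun i j => ∃ e, N.tail e = i ∧ N.head e = j) (N.tail d) (N.tail e) := by
    intro d e h
    induction h with
    | single h => exact .single ⟨d, rfl, h⟩
    | tail _ h ih => exact ih.tail ⟨_, rfl, h⟩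
  have : Std.Irrefl (Relation.TransGen (fun d e : E => N.head d = N.tail e)) :=
    ⟨fun e h => N.acyclic _ (key h)⟩
  have hwf := Finite.wellFounded_of_trans_of_irrefl
    (Relation.TransGen (fun d e : E => N.head d = N.tail e))
  exact Subrelation.wf (r := Relation.TransGen (fun d e : E => N.head d = N.tail e))
    (fun {_ _} h => Relation.TransGen.single h) hwf

end Network

/-- An `ω`-dimensional `F`-valued linear network error correction code, by its local description:
a local encoding coefficient `k_{d,e}` for each adjacent pair `(d, e)`, that is, `e ∈ E` and
`d ∈ In(tail e)`. The values of `coeff` at pairs that are not adjacent are never used. -/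
structure Code {V E : Type*} (N : Network V E) (F : Type*) (ω : ℕ) where
  coeff : Fin ω ⊕ E → E → F

namespace Code

open Classical in
/-- The indicator column vector `1_d`, indexed by `In(s) ∪ E`. -/
def indicator {E : Type*} (F : Type*) [Field F] {ω : ℕ} (d : Fin ω ⊕ E) : Fin ω ⊕ E → F :=
  Pi.single d 1

open Classical in
/-- The extended global encoding kernel of a channel `e`, by recursion along the network; see
`kernel_eq` for the defining equation. -/
def kernel {V E F : Type*} [Fintype E] [Field F] {N : Network V E} {ω : ℕ} (C : Code N F ω) :
    E → (Fin ω ⊕ E → F) :=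
  N.wellFounded_adj.fix fun e ih =>
    ∑ d : Fin ω ⊕ E,
      (match d with
        | Sum.inl i => if N.source = N.tail e then C.coeff (.inl i) e • indicator F (.inl i) else 0
        | Sum.inr d => if h : N.head d = N.tail e then C.coeff (.inr d) e • ih d h else 0)
    + indicator F (.inr e)

/-- The extended global encoding kernels of the channels in `In(s) ∪ E`; the kernel of the `i`-th
imaginary message channel is the indicator vector of that channel. -/
def kernelExt {V E F : Type*} [Fintype E] [Field F] {N : Network V E} {ω : ℕ} (C : Code N F ω) :
    Fin ω ⊕ E → (Fin ω ⊕ E → F) :=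
  Sum.elim (fun i => indicator F (.inl i)) C.kernel

/-- The recursion `f̃_e = ∑_{d ∈ In(tail e)} k_{d,e} f̃_d + 1_e`. -/
theorem kernel_eq {V E F : Type*} [Fintype E] [Field F] {N : Network V E} {ω : ℕ}
    (C : Code N F ω) (e : E) :
    C.kernel e = ∑ d ∈ N.inChannels ω (N.tail e), C.coeff d e • C.kernelExt d
      + indicator F (.inr e) := by
  classical
  rw [kernel, WellFounded.fix_eq, Network.inChannels, Finset.sum_filter]
  congr 1
  refine Finset.sum_congr (by simp) fun d _ => ?_
  rcases d with i | d
  · by_cases h : N.source = N.tail e <;> simp [Network.headExt, kernelExt, h]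
  · by_cases h : N.head d = N.tail e
    · simp only [Network.headExt, kernelExt, Sum.elim_inr, h, dif_pos, if_pos]
      rfl
    · simp [Network.headExt, h]

/-- The decoding matrix `F̃_t` at a node `t`, with columns the kernels of the channels entering `t`
and rows indexed by `In(s) ∪ E`. -/
def decodingMatrix {V E F : Type*} [Fintype E] [Field F] {N : Network V E} {ω : ℕ}
    (C : Code N F ω) (t : V) : Matrix (Fin ω ⊕ E) (N.InEdge t) F :=
  Matrix.of fun d e => C.kernel e.1 d

/-- The message space `Φ(t)`, spanned by the rows of the decoding matrix indexed by `In(s)`. -/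
def messageSpace {V E F : Type*} [Fintype E] [Field F] {N : Network V E} {ω : ℕ}
    (C : Code N F ω) (t : V) : Submodule F (N.InEdge t → F) :=
  Submodule.span F (Set.range fun i : Fin ω => (C.decodingMatrix t).row (.inl i))

/-- The error space `Δ(t, ρ)` of an error pattern `ρ ⊆ E`, spanned by the rows of the decoding
matrix indexed by `ρ`. -/
def errorSpace {V E F : Type*} [Fintype E] [Field F] {N : Network V E} {ω : ℕ}
    (C : Code N F ω) (t : V) (ρ : Finset E) : Submodule F (N.InEdge t → F) :=
  Submodule.span F ((fun e : E => (C.decodingMatrix t).row (.inr e)) '' (ρ : Set E))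

end Code

namespace Network

/-- The error pattern `ρ₁` is dominated by `ρ₂` with respect to `t`: the inclusion
`Δ(t, ρ₁) ⊆ Δ(t, ρ₂)` holds for every `ω`-dimensional `F`-valued code on the network. -/
def Dominated {V E : Type*} [Fintype E] (N : Network V E) (F : Type*) [Field F] (ω : ℕ) (t : V)
    (ρ₁ ρ₂ : Finset E) : Prop :=
  ∀ C : Code N F ω, C.errorSpace t ρ₁ ≤ C.errorSpace t ρ₂

/-- The rank of an error pattern with respect to `t`: the least cardinality of an error pattern
that dominates it. -/
def patternRank {V E : Type*} [Fintype E] (N : Network V E) (F : Type*) [Field F] (ω : ℕ) (t : V)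
    (ρ : Finset E) : ℕ :=
  sInf {n | ∃ ρ' : Finset E, N.Dominated F ω t ρ ρ' ∧ ρ'.card = n}

open Classical in
/-- The set `R_t(δ_t)` of the error patterns `ρ` with `|ρ| = rank_t(ρ) = δ_t`. -/
def rankPatterns {V E : Type*} [Fintype E] (N : Network V E) (F : Type*) [Field F] (ω : ℕ)
    (t : V) : Finset (Finset E) :=
  Finset.univ.filter fun ρ =>
    ρ.card = N.redundancy ω t ∧ N.patternRank F ω t ρ = N.redundancy ω t

end Network

namespace Code

/-- The code is regular: `dim Φ(t) = ω` at every non-source node `t` with `C_t ≥ ω`. -/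
def IsRegular {V E F : Type*} [Fintype E] [Field F] {N : Network V E} {ω : ℕ}
    (C : Code N F ω) : Prop :=
  ∀ t : V, t ≠ N.source → ω ≤ N.minCut t → Module.finrank F (C.messageSpace t) = ω

/-- The minimum distance at `t`: the least rank of an error pattern `ρ` such that
`Δ(t, ρ) ∩ Φ(t) ≠ {0}`. (It is `0`, a value that no pattern attains, if there is no such `ρ`.) -/
def minDist {V E F : Type*} [Fintype E] [Field F] {N : Network V E} {ω : ℕ}
    (C : Code N F ω) (t : V) : ℕ :=
  sInf {n | ∃ ρ : Finset E, C.errorSpace t ρ ⊓ C.messageSpace t ≠ ⊥ ∧ N.patternRank F ω t ρ = n}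

/-- The minimum distance is also the least cardinality of such an error pattern. -/
theorem minDist_eq_card {V E F : Type*} [Fintype E] [Field F] {N : Network V E} {ω : ℕ}
    (C : Code N F ω) (t : V) :
    C.minDist t =
      sInf {n | ∃ ρ : Finset E, C.errorSpace t ρ ⊓ C.messageSpace t ≠ ⊥ ∧ ρ.card = n} := by
  have hr : ∀ ρ : Finset E, ∃ ρ' : Finset E, N.Dominated F ω t ρ ρ' ∧
      ρ'.card = N.patternRank F ω t ρ := fun ρ =>
    Nat.sInf_mem (s := {n | ∃ ρ' : Finset E, N.Dominated F ω t ρ ρ' ∧ ρ'.card = n})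
      ⟨ρ.card, ρ, fun _ => le_rfl, rfl⟩
  by_cases hne : ∃ ρ : Finset E, C.errorSpace t ρ ⊓ C.messageSpace t ≠ ⊥
  · obtain ⟨ρ₀, h₀⟩ := hne
    apply le_antisymm
    · refine le_csInf ⟨_, ρ₀, h₀, rfl⟩ ?_
      rintro _ ⟨ρ, h, rfl⟩
      have h1 : N.patternRank F ω t ρ ≤ ρ.card := Nat.sInf_le ⟨ρ, fun _ => le_rfl, rfl⟩
      have h2 : C.minDist t ≤ N.patternRank F ω t ρ := Nat.sInf_le ⟨ρ, h, rfl⟩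
      exact h2.trans h1
    · refine le_csInf ⟨_, ρ₀, h₀, rfl⟩ ?_
      rintro _ ⟨ρ, h, rfl⟩
      obtain ⟨ρ', hd, hc⟩ := hr ρ
      rw [← hc]
      exact Nat.sInf_le ⟨ρ', fun hb => h (le_bot_iff.1 (hb ▸ inf_le_inf_right _ (hd C))), rfl⟩
  · simp only [not_exists] at hne
    simp [minDist, hne]

/-- The minimum distance is also the least dimension of the error space of such an error
pattern. -/
theorem minDist_eq_finrank {V E F : Type*} [Fintype E] [Field F] {N : Network V E} {ω : ℕ}
    (C : Code N F ω) (t : V) :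
    C.minDist t =
      sInf {n | ∃ ρ : Finset E, C.errorSpace t ρ ⊓ C.messageSpace t ≠ ⊥ ∧
        Module.finrank F (C.errorSpace t ρ) = n} := by
  classical
  rw [minDist_eq_card]
  by_cases hne : ∃ ρ : Finset E, C.errorSpace t ρ ⊓ C.messageSpace t ≠ ⊥
  · obtain ⟨ρ₀, h₀⟩ := hne
    apply le_antisymm
    · refine le_csInf ⟨_, ρ₀, h₀, rfl⟩ ?_
      rintro _ ⟨ρ, h, rfl⟩
      obtain ⟨b, hb, -, hs, hi⟩ := exists_linearIndepOn_extension
        (K := F) (v := fun e : E => (C.decodingMatrix t).row (.inr e)) (s := ∅) (t := (ρ : Set E))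
        (linearIndepOn_empty _ _) (Set.empty_subset _)
      have hcard : Module.finrank F (C.errorSpace t b.toFinset) = b.toFinset.card := by
        rw [errorSpace, Set.coe_toFinset, Set.image_eq_range, finrank_span_eq_card hi,
          Set.toFinset_card]
      have heq : C.errorSpace t b.toFinset = C.errorSpace t ρ := by
        apply le_antisymm
        · rw [errorSpace, Set.coe_toFinset]
          exact Submodule.span_mono (Set.image_mono hb)
        · rw [errorSpace, Submodule.span_le, errorSpace, Set.coe_toFinset]
          exact hs
      rw [← heq] at h
      exact Nat.sInf_le ⟨b.toFinset, h, by rw [← heq, hcard]⟩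
    · refine le_csInf ⟨_, ρ₀, h₀, rfl⟩ ?_
      rintro _ ⟨ρ, h, rfl⟩
      have h1 : Module.finrank F (C.errorSpace t ρ) ≤ ρ.card := by
        refine (finrank_span_le_card _).trans ?_
        rw [Set.toFinset_card, ← Nat.card_eq_fintype_card]
        exact (Nat.card_image_le ρ.finite_toSet).trans (by simp)
      refine le_trans ?_ h1
      exact Nat.sInf_le ⟨ρ, h, rfl⟩
  · simp only [not_exists] at hne
    simp [hne]

/-- A linear network error correction multicast MDS code: it is regular, and its minimum distance
is `δ_t + 1` at every non-source node `t` with `C_t ≥ ω`. -/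
def IsMulticastMDS {V E F : Type*} [Fintype E] [Field F] {N : Network V E} {ω : ℕ}
    (C : Code N F ω) : Prop :=
  C.IsRegular ∧
    ∀ t : V, t ≠ N.source → ω ≤ N.minCut t → C.minDist t = N.redundancy ω t + 1

end Code

end LNEC

end

noncomputable section

open Classical Matrix

namespace LNEC

variable {V E F : Type*} [Fintype E] [Field F] {ω : ℕ}

/-! ### Linkings to a node and the associated minors of 1 - K -/

namespace Network

/-- Induction against the direction of the channels of a finite acyclic network. -/
theorem channel_induction (N : Network V E) (ω : ℕ) {P : Fin ω ⊕ E → Prop}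
    (h : ∀ d, (∀ e, N.headExt ω d = N.tail e → P (.inr e)) → P d) (d : Fin ω ⊕ E) : P d := by
  have hwf : WellFounded (fun e d : E => N.head d = N.tail e) := by
    have htr := N.wellFounded_adj.transGen
    have : IsTrans E (fun e d : E => Relation.TransGen (fun d e : E => N.head d = N.tail e) d e) :=
      ⟨fun _ _ _ h₁ h₂ => h₂.trans h₁⟩
    have : Std.Irrefl
        (fun e d : E => Relation.TransGen (fun d e : E => N.head d = N.tail e) d e) :=
      ⟨fun e he => htr.irrefl.irrefl e he⟩
    exact Subrelation.wf
      (r := fun e d : E => Relation.TransGen (fun d e : E => N.head d = N.tail e) d e)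
      (fun {_ _} h => Relation.TransGen.single h) (Finite.wellFounded_of_trans_of_irrefl
        (fun e d : E => Relation.TransGen (fun d e : E => N.head d = N.tail e) d e))
  have hE : ∀ e : E, P (.inr e) := fun e => hwf.induction e fun e ih => h _ fun e' he' => ih e' he'
  exact h d fun e _ => hE e

/-- The matrix of local coefficients, indexed by all pairs of channels. -/
def transfer (N : Network V E) (k : (Fin ω ⊕ E) × E → F) :
    Matrix (Fin ω ⊕ E) (Fin ω ⊕ E) F :=
  Matrix.of fun d =>
    Sum.elim (fun _ => 0) (fun e => if N.headExt ω d = N.tail e then k (d, e) else 0)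

/-- A set of channels together with all channels that directly follow one of them. -/
def closedNbhd (N : Network V E) (A : Finset (Fin ω ⊕ E)) : Finset (Fin ω ⊕ E) :=
  A ∪ Finset.univ.filter fun x => ∃ e, x = .inr e ∧ ∃ d ∈ A, N.headExt ω d = N.tail e

theorem mem_closedNbhd (N : Network V E) {A : Finset (Fin ω ⊕ E)} {x : Fin ω ⊕ E} :
    x ∈ N.closedNbhd A ↔ x ∈ A ∨ ∃ e, x = .inr e ∧ ∃ d ∈ A, N.headExt ω d = N.tail e := by
  simp [closedNbhd]

theorem inl_mem_closedNbhd (N : Network V E) {A : Finset (Fin ω ⊕ E)} {i : Fin ω} :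
    .inl i ∈ N.closedNbhd A ↔ .inl i ∈ A := by
  simp [mem_closedNbhd]

/-- A form of Menger's theorem: if every set of channels that separates `S` from `t` has at least
`|S|` elements, then `S` can be linked to `t`. The linking is encoded by the map that sends a
channel on one of its paths to the next one, and fixes the channels off the paths. -/
theorem exists_linking (N : Network V E) (t : V) (S : Finset (Fin ω ⊕ E))
    (h : ∀ A : Finset (Fin ω ⊕ E), (∀ d ∈ A, N.headExt ω d ≠ t) →
      S.card ≤ ((N.closedNbhd A \ A) ∪ (S \ N.closedNbhd A)).card) :
    ∃ φ : {d : Fin ω ⊕ E // N.headExt ω d ≠ t} → Fin ω ⊕ E, Function.Injective φ ∧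
      ∀ d, φ d ∉ S ∧ (φ d = d.1 ∨ ∃ e, φ d = .inr e ∧ N.headExt ω d.1 = N.tail e) := by
  -- The map is a system of distinct representatives for these sets, so Hall's condition is what has
  -- to be checked.
  let nb : {d : Fin ω ⊕ E // N.headExt ω d ≠ t} → Finset (Fin ω ⊕ E) :=
    fun d => N.closedNbhd {d.1} \ S
  have hall : ∀ A : Finset {d : Fin ω ⊕ E // N.headExt ω d ≠ t},
      A.card ≤ (A.biUnion nb).card := by
    intro A
    set B : Finset (Fin ω ⊕ E) := A.map (Function.Embedding.subtype _) with hB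
    have hBt : ∀ d ∈ B, N.headExt ω d ≠ t := by
      intro d hd
      obtain ⟨a, -, rfl⟩ := Finset.mem_map.1 hd
      exact a.2
    have hU : A.biUnion nb = N.closedNbhd B \ S := by
      ext x
      simp only [nb, hB, Finset.mem_biUnion, Finset.mem_sdiff, mem_closedNbhd, Finset.mem_map,
        Finset.mem_singleton, Function.Embedding.subtype_apply]
      constructor
      · rintro ⟨a, ha, rfl | ⟨e, rfl, d, rfl, he⟩, hx⟩
        · exact ⟨.inl ⟨a, ha, rfl⟩, hx⟩
        · exact ⟨.inr ⟨e, rfl, a, ⟨a, ha, rfl⟩, he⟩, hx⟩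
      · rintro ⟨⟨a, ha, rfl⟩ | ⟨e, rfl, _, ⟨a, ha, rfl⟩, he⟩, hx⟩
        · exact ⟨a, ha, .inl rfl, hx⟩
        · exact ⟨a, ha, .inr ⟨e, rfl, a, rfl, he⟩, hx⟩
    have hsub : B ⊆ N.closedNbhd B := Finset.subset_union_left
    -- With N[B] the closed neighbourhood, |N[B] \ S| - |B| = |N[B] \ B| + |S \ N[B]| - |S|, so the
    -- separator inequality is Hall's condition.
    have h1 := (h B hBt).trans (Finset.card_union_le _ _)
    have h2 := Finset.card_sdiff_add_card_eq_card hsub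
    have h3 := Finset.card_sdiff_add_card_inter S (N.closedNbhd B)
    have h4 := Finset.card_sdiff_add_card_inter (N.closedNbhd B) S
    rw [Finset.inter_comm] at h4
    have h5 : B.card = A.card := Finset.card_map _
    rw [hU]
    omega
  obtain ⟨φ, hφ, hmem⟩ := (Finset.all_card_le_biUnion_card_iff_exists_injective nb).1 hall
  refine ⟨φ, hφ, fun d => ?_⟩
  have := hmem d
  simpa [nb, mem_closedNbhd, and_comm] using this

/-- The minor of `1 - K` with rows the channels that do not enter `t` and columns given by `φ`. -/
def linkingDet (N : Network V E) (t : V)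
    (φ : {d : Fin ω ⊕ E // N.headExt ω d ≠ t} → Fin ω ⊕ E) (k : (Fin ω ⊕ E) × E → F) : F :=
  (Matrix.of fun d d' => (1 - N.transfer k) d.1 (φ d')).det

/-- Put coefficient 1 along the paths of φ and 0 elsewhere. A vector in the left kernel is then
constant along each path and vanishes where the path enters t, as well as at the fixed points of φ.
-/
theorem exists_linkingDet_ne_zero (N : Network V E) (t : V)
    (φ : {d : Fin ω ⊕ E // N.headExt ω d ≠ t} → Fin ω ⊕ E) (hφ : Function.Injective φ)
    (hadj : ∀ d, φ d = d.1 ∨ ∃ e, φ d = .inr e ∧ N.headExt ω d.1 = N.tail e) :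
    ∃ k : (Fin ω ⊕ E) × E → F, N.linkingDet t φ k ≠ 0 := by
  refine ⟨fun p => if h : N.headExt ω p.1 ≠ t then if φ ⟨p.1, h⟩ = .inr p.2 then 1 else 0 else 0,
    fun h0 => ?_⟩
  set k : (Fin ω ⊕ E) × E → F := fun p =>
    if h : N.headExt ω p.1 ≠ t then if φ ⟨p.1, h⟩ = .inr p.2 then 1 else 0 else 0 with hk
  obtain ⟨y, hy, hy0⟩ := Matrix.exists_vecMul_eq_zero_iff.2 h0
  apply hy
  have hoff : ∀ d d', d ≠ d' → N.transfer k d.1 (φ d') = 0 := by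
    intro d d' hne
    rcases hx : φ d' with i | e
    · simp [transfer]
    · have : φ d ≠ .inr e := fun h => hne (hφ (h.trans hx.symm))
      simp [transfer, hk, this]
  -- By injectivity of φ, column φ d' of K has its only possible nonzero entry, among the rows used,
  -- in row d'.
  have key : ∀ d', (if h : N.headExt ω (φ d') ≠ t then y ⟨φ d', h⟩ else 0)
      = y d' * N.transfer k d'.1 (φ d') := by
    intro d'
    have := congrFun hy0 d'
    simp only [Matrix.vecMul, dotProduct, Matrix.of_apply, Matrix.sub_apply, mul_sub,
      Finset.sum_sub_distrib, Pi.zero_apply, sub_eq_zero] at this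
    rw [Finset.sum_eq_single (f := fun d => y d * N.transfer k d.1 (φ d')) d'
      (fun d _ hne => by rw [hoff d d' hne, mul_zero]) (by simp)] at this
    rw [← this]
    split_ifs with h
    · rw [Finset.sum_eq_single ⟨φ d', h⟩]
      · simp
      · intro d _ hne
        rw [Matrix.one_apply_ne, mul_zero]
        exact fun h' => hne (Subtype.ext h')
      · simp
    · symm
      refine Finset.sum_eq_zero fun d _ => ?_
      rw [Matrix.one_apply_ne, mul_zero]
      exact fun h' => h (h' ▸ d.2)
  have hall : ∀ d : Fin ω ⊕ E, ∀ h : N.headExt ω d ≠ t, y ⟨d, h⟩ = 0 := by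
    refine N.channel_induction ω fun d ih h => ?_
    have hd := key ⟨d, h⟩
    by_cases hs : φ ⟨d, h⟩ = d
    -- Acyclicity excludes loops, so at a fixed point the kernel equation reads y d = 0.
    · have hz : N.transfer k d d = 0 := by
        rcases d with i | e
        · simp [transfer]
        · have : N.head e ≠ N.tail e := fun he =>
            N.acyclic (N.tail e) (Relation.TransGen.single ⟨e, rfl, he⟩)
          simp [transfer, headExt, this]
      simpa [hs, hz, h] using hd
    · obtain ⟨e, he, hde⟩ := (hadj ⟨d, h⟩).resolve_left hs
      have h1 : N.transfer k d (φ ⟨d, h⟩) = 1 := by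
        simp only at hde
        rw [he]
        simp [transfer, hk, hde, he]
        exact hde ▸ h
      rw [h1, mul_one] at hd
      rw [← hd]
      split_ifs with h'
      · simp only [he]
        exact ih e hde (he ▸ h')
      · rfl
  funext d
  exact hall d.1 d.2

/-- The minor is an affine function of each single coefficient. -/
theorem linkingDet_update (N : Network V E) (t : V)
    (φ : {d : Fin ω ⊕ E // N.headExt ω d ≠ t} → Fin ω ⊕ E) (k : (Fin ω ⊕ E) × E → F)
    (j : (Fin ω ⊕ E) × E) :
    ∃ α β : F, ∀ a, N.linkingDet t φ (Function.update k j a) = α + a * β := by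
  obtain ⟨d₀, e₀⟩ := j
  by_cases h : N.headExt ω d₀ ≠ t
  -- The coefficient occurs only in row d₀, where the determinant is linear: `M` has it set to 0,
  -- and `v` is what it multiplies in that row.
  · let M : Matrix {d : Fin ω ⊕ E // N.headExt ω d ≠ t} {d : Fin ω ⊕ E // N.headExt ω d ≠ t} F :=
      Matrix.of fun d d' => (1 - N.transfer (Function.update k (d₀, e₀) 0)) d.1 (φ d')
    let v : {d : Fin ω ⊕ E // N.headExt ω d ≠ t} → F :=
      fun d' => -(if φ d' = .inr e₀ ∧ N.headExt ω d₀ = N.tail e₀ then 1 else 0)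
    refine ⟨M.det, (M.updateRow ⟨d₀, h⟩ v).det, fun a => ?_⟩
    have : M.det = (M.updateRow ⟨d₀, h⟩ (M ⟨d₀, h⟩)).det := by rw [Matrix.updateRow_eq_self]
    rw [this, ← Matrix.det_updateRow_smul, ← Matrix.det_updateRow_add, linkingDet]
    congr 1
    ext d d'
    by_cases hd : d = ⟨d₀, h⟩
    · subst hd
      rw [Matrix.updateRow_self]
      rcases hx : φ d' with i | e
      · simp [M, v, transfer, hx]
      · by_cases hee : e = e₀
        · subst hee
          by_cases hh : N.headExt ω d₀ = N.tail e <;> simp [M, v, transfer, hx, hh]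
          ring
        · simp [M, v, transfer, hx, hee]
    · rw [Matrix.updateRow_ne hd]
      have hd' : d.1 ≠ d₀ := fun h' => hd (Subtype.ext h')
      rcases hx : φ d' with i | e <;> simp [M, transfer, hx, hd']
  · refine ⟨N.linkingDet t φ k, 0, fun a => ?_⟩
    rw [mul_zero, add_zero, linkingDet, linkingDet]
    congr 1
    ext d d'
    have hd' : d.1 ≠ d₀ := fun h' => h (h' ▸ d.2)
    rcases hx : φ d' with i | e <;> simp [transfer, hx, hd']

end Network

/-! ### A common nonzero of functions affine in each variable -/

/-- Finitely many functions, each affine in every single coordinate and none of them zero, have a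
common point of non-vanishing, provided that the field has more elements than there are
functions. -/
theorem exists_forall_ne_zero_of_affine {ι κ : Type*} [Finite ι] [DecidableEq ι] (I : Finset κ)
    (hI : (I.card : Cardinal) < Cardinal.mk F) (g : κ → (ι → F) → F)
    (haff : ∀ i ∈ I, ∀ x j, ∃ α β : F, ∀ a, g i (Function.update x j a) = α + a * β)
    (hne : ∀ i ∈ I, ∃ x, g i x ≠ 0) : ∃ x, ∀ i ∈ I, g i x ≠ 0 := by
  have := Fintype.ofFinite ι
  -- Only the coordinates in J are settled; off J each function keeps a nonvanishing witness of its
  -- own.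
  have key : ∀ J : Finset ι, ∃ x : ι → F, ∀ i ∈ I, ∃ y, (∀ j ∈ J, y j = x j) ∧ g i y ≠ 0 := by
    intro J
    induction J using Finset.induction_on with
    | empty => exact ⟨0, fun i hi => (hne i hi).imp fun y hy => ⟨by simp, hy⟩⟩
    | insert j J hj ih =>
      obtain ⟨x, hx⟩ := ih
      choose! y hyx hy using hx
      have hroot : ∀ i ∈ I, ∃ r : F, ∀ a, a ≠ r → g i (Function.update (y i) j a) ≠ 0 := by
        intro i hi
        obtain ⟨α, β, h⟩ := haff i hi (y i) j
        have h0 : α + y i j * β ≠ 0 := by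
          rw [← h, Function.update_eq_self]
          exact hy i hi
        -- If β = 0 the function is a nonzero constant in this coordinate, and the value 0 is
        -- excluded needlessly but harmlessly.
        refine ⟨-α / β, fun a ha h1 => ?_⟩
        rw [h] at h1
        by_cases hβ : β = 0
        · simp_all
        · exact ha (by field_simp; linear_combination h1)
      choose! r hr using hroot
      obtain ⟨a, ha⟩ : ∃ a, a ∉ I.image r := by
        by_contra! hall
        have : Cardinal.mk F ≤ (I.image r).card := by
          rw [← Cardinal.mk_coe_finset, ← Cardinal.mk_univ]
          exact Cardinal.mk_le_mk_of_subset fun a _ => hall a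
        exact absurd hI (not_lt.2 (this.trans (by exact_mod_cast Finset.card_image_le)))
      refine ⟨Function.update x j a, fun i hi => ⟨Function.update (y i) j a, ?_, hr i hi a ?_⟩⟩
      · intro j' hj'
        by_cases h : j' = j
        · subst h; simp
        · simp [h, hyx i hi j' (Finset.mem_of_mem_insert_of_ne hj' h)]
      · rintro rfl
        exact ha (Finset.mem_image_of_mem _ hi)
  obtain ⟨x, hx⟩ := key Finset.univ
  refine ⟨x, fun i hi => ?_⟩
  obtain ⟨y, hyx, hy⟩ := hx i hi
  rwa [← funext fun j => hyx j (Finset.mem_univ j)]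

/-! ### The kernel matrix as an inverse, and relations among decoding rows -/

namespace Code

variable {N : Network V E}

/-- The matrix of all extended kernels. -/
def kernelMatrix (C : Code N F ω) : Matrix (Fin ω ⊕ E) (Fin ω ⊕ E) F :=
  Matrix.of fun x d => C.kernelExt x d

/-- The matrix of local coefficients of a code. -/
abbrev transfer (C : Code N F ω) : Matrix (Fin ω ⊕ E) (Fin ω ⊕ E) F :=
  N.transfer fun p => C.coeff p.1 p.2

theorem kernelMatrix_eq (C : Code N F ω) :
    C.kernelMatrix = C.transferᵀ * C.kernelMatrix + 1 := by
  ext x d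
  rw [Matrix.add_apply, Matrix.mul_apply]
  rcases x with i | e
  · simp [kernelMatrix, kernelExt, Network.transfer, indicator, Pi.single_apply,
      Matrix.one_apply, eq_comm]
  · have h := congrFun (C.kernel_eq e) d
    simp only [kernelMatrix, Matrix.of_apply]
    rw [show C.kernelExt (.inr e) = C.kernel e from rfl, h]
    simp [Network.inChannels, Finset.sum_filter, Network.transfer, indicator, Pi.single_apply,
      Matrix.one_apply, eq_comm, Finset.sum_apply, ite_apply]

theorem one_sub_mul_kernelMatrix (C : Code N F ω) :
    (1 - C.transferᵀ) * C.kernelMatrix = 1 := by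
  rw [sub_mul, one_mul, sub_eq_iff_eq_add']
  exact C.kernelMatrix_eq

theorem kernelMatrix_mul_one_sub (C : Code N F ω) :
    C.kernelMatrix * (1 - C.transferᵀ) = 1 :=
  mul_eq_one_comm.1 C.one_sub_mul_kernelMatrix

/-- The rows of the decoding matrix. -/
abbrev row (C : Code N F ω) (t : V) (d : Fin ω ⊕ E) : N.InEdge t → F :=
  (C.decodingMatrix t).row d

theorem row_apply (C : Code N F ω) (t : V) (d : Fin ω ⊕ E) (e : N.InEdge t) :
    C.row t d e = C.kernelMatrix (.inr e.1) d := rfl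

/-- The kernel recursion looks upstream; using the inverse on the other side gives the dual
recursion downstream: an error on d reaches t only through the channels that follow d. -/
theorem row_eq_sum (C : Code N F ω) {t : V} {d : Fin ω ⊕ E} (hd : N.headExt ω d ≠ t) :
    C.row t d = ∑ e : E, (if N.headExt ω d = N.tail e then C.coeff d e else 0) •
      C.row t (.inr e) := by
  funext e'
  have h := congrFun (congrFun C.kernelMatrix_mul_one_sub (.inr e'.1)) d
  have hne : (.inr e'.1 : Fin ω ⊕ E) ≠ d := by
    rintro rfl
    exact hd e'.2
  rw [mul_sub, mul_one, Matrix.sub_apply, Matrix.one_apply_ne hne, sub_eq_zero,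
    Matrix.mul_apply] at h
  rw [row_apply, h]
  simp only [Finset.sum_apply, Pi.smul_apply, smul_eq_mul, row_apply]
  simp [Network.transfer, mul_comm]

/-- The rows of the channels of `A` are combinations of the rows of the channels by which one
leaves `A`. -/
theorem row_mem_span (C : Code N F ω) {t : V} {A : Finset (Fin ω ⊕ E)}
    (hA : ∀ d ∈ A, N.headExt ω d ≠ t) {Z : Finset E}
    (hZ : ∀ d ∈ A, ∀ e, N.headExt ω d = N.tail e → .inr e ∈ A ∨ e ∈ Z) (d : Fin ω ⊕ E)
    (hd : d ∈ A) : C.row t d ∈ C.errorSpace t Z := by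
  revert d
  refine N.channel_induction ω fun d ih hd => ?_
  rw [C.row_eq_sum (hA d hd)]
  refine Submodule.sum_mem _ fun e _ => ?_
  split_ifs with h
  · refine Submodule.smul_mem _ _ ?_
    rcases hZ d hd e h with he | he
    · exact ih e h he
    · exact Submodule.subset_span ⟨e, he, rfl⟩
  · simp

/-- A relation c supported on S gives y = Gc, with G the kernel matrix, vanishing on In(t), while (1
- Kᵀ)y = c vanishes off S. The rest of y is killed by a minor whose columns lie off S, so y = 0 and
c = 0. -/
theorem linearIndepOn_row (C : Code N F ω) {t : V} (ht : t ≠ N.source) {S : Finset (Fin ω ⊕ E)}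
    (φ : {d : Fin ω ⊕ E // N.headExt ω d ≠ t} → Fin ω ⊕ E) (hS : ∀ d, φ d ∉ S)
    (hdet : N.linkingDet t φ (fun p => C.coeff p.1 p.2) ≠ 0) :
    LinearIndepOn F (C.row t) (S : Set (Fin ω ⊕ E)) := by
  rw [linearIndepOn_finset_iff]
  intro f hf
  set c : Fin ω ⊕ E → F := fun d => if d ∈ S then f d else 0 with hc
  set y := C.kernelMatrix *ᵥ c with hy
  have hyc : (1 - C.transferᵀ) *ᵥ y = c := by
    rw [hy, Matrix.mulVec_mulVec, one_sub_mul_kernelMatrix, Matrix.one_mulVec]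
  have hyT : ∀ d, N.headExt ω d = t → y d = 0 := by
    rintro (i | e) he
    · exact absurd he.symm ht
    · have := congrFun hf ⟨e, he⟩
      simp only [Finset.sum_apply, Pi.smul_apply, smul_eq_mul, Pi.zero_apply, row_apply] at this
      rw [← this, hy, Matrix.mulVec, dotProduct]
      simp [hc, mul_comm]
  have hy' : (fun d : {d : Fin ω ⊕ E // N.headExt ω d ≠ t} => y d.1) = 0 := by
    refine Matrix.eq_zero_of_vecMul_eq_zero hdet (funext fun d' => ?_)
    have h := congrFun hyc (φ d')
    rw [hc] at h
    simp only [hS d', if_false] at h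
    have hsum := Finset.sum_subtype (F := inferInstance) (p := fun d => N.headExt ω d ≠ t)
      (Finset.univ.filter fun d => N.headExt ω d ≠ t) (by simp)
      (fun d => y d * (1 - C.transfer) d (φ d'))
    rw [Pi.zero_apply, ← h]
    refine hsum.symm.trans ?_
    rw [Finset.sum_filter]
    refine Finset.sum_congr rfl fun d _ => ?_
    split_ifs with hd
    · rw [mul_comm]
      simp [Matrix.one_apply, eq_comm]
    · rw [hyT d (not_not.1 hd), mul_zero]
  have hy0 : y = 0 := funext fun d => by
    by_cases hd : N.headExt ω d = t
    · exact hyT d hd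
    · exact congrFun hy' ⟨d, hd⟩
  intro d hd
  have := congrFun hyc d
  rw [hy0, Matrix.mulVec_zero] at this
  simpa [hc, hd] using this.symm

/-- The rows of the channels in `E` span the whole space. -/
theorem span_row_eq_top (C : Code N F ω) {t : V} (ht : t ≠ N.source) :
    C.errorSpace t Finset.univ = ⊤ := by
  have hmem : ∀ d, C.row t d ∈ C.errorSpace t Finset.univ := by
    rintro (i | e)
    · exact C.row_mem_span (A := {.inl i}) (by simpa [Network.headExt] using ht.symm)
        (by simp) _ (by simp)
    · exact Submodule.subset_span ⟨e, by simp, rfl⟩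
  rw [eq_top_iff]
  intro v _
  -- Extend v by zero to all channels; the coefficients (1 - Kᵀ)w reproduce w through the kernel
  -- matrix, hence v on In(t).
  set w : Fin ω ⊕ E → F :=
    Sum.elim 0 fun e => if h : N.head e = t then v ⟨e, h⟩ else 0 with hw
  have hGw : C.kernelMatrix *ᵥ ((1 - C.transferᵀ) *ᵥ w) = w := by
    rw [Matrix.mulVec_mulVec, kernelMatrix_mul_one_sub, Matrix.one_mulVec]
  have : v = ∑ d, ((1 - C.transferᵀ) *ᵥ w) d • C.row t d := by
    funext e
    have h := congrFun hGw (.inr e.1)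
    simp only [hw, Sum.elim_inr, e.2, dif_pos] at h
    rw [← h, Matrix.mulVec, dotProduct]
    simp only [Finset.sum_apply, Pi.smul_apply, smul_eq_mul, row_apply, hw]
    exact Finset.sum_congr rfl fun d _ => mul_comm _ _
  rw [this]
  exact Submodule.sum_mem _ fun d _ => Submodule.smul_mem _ _ (hmem d)

end Code

/-! ### Cuts, domination and the rank of error patterns -/

namespace Network

variable (N : Network V E)

/-- A path from the source avoiding Z visits only heads of channels of A, none of which is t. -/
theorem isCut_of_closed {E : Type*} (N : Network V E) {t : V} {A : Finset (Fin ω ⊕ E)}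
    (hA : ∀ d ∈ A, N.headExt ω d ≠ t) {Z : Finset E}
    (hZ : ∀ d ∈ A, ∀ e, N.headExt ω d = N.tail e → .inr e ∈ A ∨ e ∈ Z) {i : Fin ω}
    (hi : .inl i ∈ A) : N.IsCut t Z := by
  intro h
  have : ∃ d ∈ A, N.headExt ω d = t := by
    clear hA
    induction h with
    | refl => exact ⟨.inl i, hi, rfl⟩
    | tail _ h ih =>
      obtain ⟨d, hd, hdv⟩ := ih
      obtain ⟨e, he, hev, rfl⟩ := h
      exact ⟨.inr e, (hZ d hd e (hdv.trans hev.symm)).resolve_right he, rfl⟩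
  obtain ⟨d, hd, h⟩ := this
  exact hA d hd h

theorem minCut_le {E : Type*} (N : Network V E) {t : V} {Z : Finset E} (h : N.IsCut t Z) : N.minCut t ≤ Z.card :=
  Nat.sInf_le ⟨Z, h, rfl⟩

theorem exists_isCut_card {t : V} (ht : t ≠ N.source) :
    ∃ Z : Finset E, N.IsCut t Z ∧ Z.card = N.minCut t :=
  Nat.sInf_mem (s := {n | ∃ A : Finset E, N.IsCut t A ∧ A.card = n})
    ⟨_, _, N.isCut_univ ht, rfl⟩

theorem minCut_le_card_inEdge {t : V} (ht : t ≠ N.source) :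
    N.minCut t ≤ Fintype.card (N.InEdge t) := by
  rw [Fintype.card_subtype]
  refine N.minCut_le fun h => ?_
  rcases Relation.ReflTransGen.cases_tail h with h | ⟨_, -, e, he, -, hh⟩
  · exact ht h
  · simp [hh] at he

theorem dominated_of_closed {t : V} {A : Finset (Fin ω ⊕ E)}
    (hA : ∀ d ∈ A, N.headExt ω d ≠ t) {Z ρ : Finset E}
    (hZ : ∀ d ∈ A, ∀ e, N.headExt ω d = N.tail e → .inr e ∈ A ∨ e ∈ Z)
    (hρ : ∀ e ∈ ρ, .inr e ∈ A ∨ e ∈ Z) : N.Dominated F ω t ρ Z := by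
  intro C
  refine Submodule.span_le.2 ?_
  rintro _ ⟨e, he, rfl⟩
  rcases hρ e he with h | h
  · exact C.row_mem_span hA hZ _ h
  · exact Submodule.subset_span ⟨e, h, rfl⟩

theorem patternRank_le {t : V} {ρ Z : Finset E} (h : N.Dominated F ω t ρ Z) :
    N.patternRank F ω t ρ ≤ Z.card :=
  Nat.sInf_le ⟨Z, h, rfl⟩

theorem patternRank_le_card (t : V) (ρ : Finset E) : N.patternRank F ω t ρ ≤ ρ.card :=
  N.patternRank_le fun _ => le_rfl

theorem exists_dominated_card (F : Type*) [Field F] (ω : ℕ) (t : V) (ρ : Finset E) :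
    ∃ Z : Finset E, N.Dominated F ω t ρ Z ∧ Z.card = N.patternRank F ω t ρ :=
  Nat.sInf_mem (s := {n | ∃ Z : Finset E, N.Dominated F ω t ρ Z ∧ Z.card = n})
    ⟨_, ρ, fun _ => le_rfl, rfl⟩

theorem finrank_errorSpace_le {N : Network V E} (C : Code N F ω) (t : V) (ρ : Finset E) :
    Module.finrank F (C.errorSpace t ρ) ≤ ρ.card := by
  rw [Code.errorSpace, ← Finset.coe_image]
  exact (finrank_span_finset_le_card _).trans Finset.card_image_le

theorem finrank_errorSpace_eq {N : Network V E} {C : Code N F ω} {t : V} {ρ : Finset E}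
    (h : LinearIndepOn F (fun e => C.row t (.inr e)) (ρ : Set E)) :
    Module.finrank F (C.errorSpace t ρ) = ρ.card := by
  rw [Code.errorSpace, Set.image_eq_range]
  exact (finrank_span_eq_card h).trans (by simp)

/-- One code certifies full rank: a dominating pattern must already span a space of dimension |ρ| in
it. -/
theorem patternRank_eq_card {C : Code N F ω} {t : V} {ρ : Finset E}
    (h : LinearIndepOn F (fun e => C.row t (.inr e)) (ρ : Set E)) :
    N.patternRank F ω t ρ = ρ.card := by
  refine (N.patternRank_le_card t ρ).antisymm ?_
  obtain ⟨Z, hZ, hc⟩ := N.exists_dominated_card F ω t ρ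
  rw [← hc, ← finrank_errorSpace_eq h]
  exact (Submodule.finrank_mono (hZ C)).trans (finrank_errorSpace_le C t Z)

/-- A set of `|I|` message channels and an error pattern of full rank can together be linked to
`t` if they number at most `C_t` or there are no message channels. -/
theorem exists_linking_disjSum (F : Type*) [Field F] {t : V}
    (I : Finset (Fin ω)) {ρ : Finset E} (hρ : N.patternRank F ω t ρ = ρ.card)
    (hI : I.Nonempty → I.card + ρ.card ≤ N.minCut t) :
    ∃ φ : {d : Fin ω ⊕ E // N.headExt ω d ≠ t} → Fin ω ⊕ E, Function.Injective φ ∧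
      ∀ d, φ d ∉ I.disjSum ρ ∧
        (φ d = d.1 ∨ ∃ e, φ d = .inr e ∧ N.headExt ω d.1 = N.tail e) := by
  refine N.exists_linking t _ fun A hA => ?_
  set Y := (N.closedNbhd A \ A) ∪ (I.disjSum ρ \ N.closedNbhd A) with hY
  set Z : Finset E := Finset.univ.filter fun e => .inr e ∈ Y with hZdef
  have hZ : ∀ d ∈ A, ∀ e, N.headExt ω d = N.tail e → .inr e ∈ A ∨ e ∈ Z := by
    intro d hd e he
    have : (.inr e : Fin ω ⊕ E) ∈ N.closedNbhd A :=
      N.mem_closedNbhd.2 (.inr ⟨e, rfl, d, hd, he⟩)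
    by_cases h : (.inr e : Fin ω ⊕ E) ∈ A <;> simp [hZdef, hY, h, this]
  rw [Finset.card_disjSum]
  -- If A contains a message channel of I, the real channels of the separator form a cut. Otherwise
  -- every message channel of I lies in the separator, whose real channels dominate ρ and so number
  -- at least |ρ|.
  by_cases hi : ∃ i ∈ I, .inl i ∈ A
  · obtain ⟨i, hiI, hiA⟩ := hi
    refine (hI ⟨i, hiI⟩).trans ((N.minCut_le (N.isCut_of_closed hA hZ hiA)).trans ?_)
    rw [← Finset.card_map ⟨Sum.inr, Sum.inr_injective⟩]
    refine Finset.card_le_card fun x hx => ?_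
    obtain ⟨e, he, rfl⟩ := Finset.mem_map.1 hx
    exact (Finset.mem_filter.1 he).2
  · push Not at hi
    have hdom : N.Dominated F ω t ρ Z := by
      refine N.dominated_of_closed hA hZ fun e he => ?_
      by_cases h : (.inr e : Fin ω ⊕ E) ∈ A
      · exact .inl h
      · by_cases h' : (.inr e : Fin ω ⊕ E) ∈ N.closedNbhd A <;> simp [hZdef, hY, h, h', he]
    have h1 := N.patternRank_le hdom
    have h2 : I.disjSum Z ⊆ Y := by
      rintro (i | e) hx
      · have hiI : i ∈ I := by simpa using hx
        simp [hY, inl_mem_closedNbhd, hi i hiI, hiI]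
      · simpa [hZdef] using hx
    have h3 := Finset.card_le_card h2
    rw [Finset.card_disjSum] at h3
    omega

/-- An error pattern of full rank extends to larger ones, up to the number of channels entering
`t`. -/
theorem exists_superset_patternRank_eq (F : Type*) [Field F] (ω : ℕ) {t : V}
    (ht : t ≠ N.source) {ρ : Finset E} (hρ : N.patternRank F ω t ρ = ρ.card) {n : ℕ}
    (hn : ρ.card ≤ n) (hnt : n ≤ Fintype.card (N.InEdge t)) :
    ∃ ρ', ρ ⊆ ρ' ∧ ρ'.card = n ∧ N.patternRank F ω t ρ' = n := by
  obtain ⟨φ, hinj, hφ⟩ := N.exists_linking_disjSum F ∅ hρ (by simp)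
  obtain ⟨k, hk⟩ := N.exists_linkingDet_ne_zero (F := F) t φ hinj fun d => (hφ d).2
  -- In this code the rows of ρ are independent and extend to a basis of rows; the same code
  -- certifies the rank of every pattern inside that basis.
  let C : Code N F ω := ⟨fun d e => k (d, e)⟩
  have hlin := C.linearIndepOn_row ht φ (fun d => (hφ d).1) hk
  have hlinρ : LinearIndepOn F (fun e => C.row t (.inr e)) (ρ : Set E) :=
    (hlin.mono (t := Sum.inr '' (ρ : Set E)) (by simp)).comp_of_image Sum.inr_injective.injOn
  obtain ⟨b, -, hρb, hspan, hb⟩ := exists_linearIndepOn_extension hlinρ (Set.subset_univ _)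
  have hbtop : C.errorSpace t b.toFinset = ⊤ := by
    rw [eq_top_iff, ← C.span_row_eq_top ht, Code.errorSpace, Code.errorSpace, Submodule.span_le]
    simpa using hspan
  have hb' : LinearIndepOn F (fun e => C.row t (.inr e)) (b.toFinset : Set E) := by simpa using hb
  have hbc := finrank_errorSpace_eq hb'
  rw [hbtop, finrank_top, Module.finrank_fintype_fun_eq_card] at hbc
  obtain ⟨ρ', h1, h2, h3⟩ := Finset.exists_subsuperset_card_eq
    (s := ρ) (t := b.toFinset) (by simpa [← Finset.coe_subset] using hρb) hn (hbc ▸ hnt)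
  refine ⟨ρ', h1, h3, ?_⟩
  rw [← h3]
  exact N.patternRank_eq_card (hb'.mono (by simpa using h2))

end Network

/-! ### The Singleton bound and a criterion for MDS codes -/

namespace Code

variable {N : Network V E}

theorem message_mem_errorSpace (C : Code N F ω) {t : V} {Z : Finset E}
    (hZ : N.IsCut t Z) (i : Fin ω) : C.row t (.inl i) ∈ C.errorSpace t Z := by
  let R : V → Prop := Relation.ReflTransGen
    (fun i j => ∃ e, e ∉ Z ∧ N.tail e = i ∧ N.head e = j) N.source
  have hR : ∀ e, e ∉ Z → R (N.tail e) → R (N.head e) := fun e he h => h.tail ⟨e, he, rfl, rfl⟩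
  -- The channels on the source side of the cut: the messages, and the channels outside Z that start
  -- at a node reachable without Z.
  let A : Finset (Fin ω ⊕ E) := Finset.univ.filter
    (Sum.elim (fun _ => True) fun e => e ∉ Z ∧ R (N.tail e))
  have hAR : ∀ d ∈ A, R (N.headExt ω d) := by
    rintro (i | e) hd
    · exact .refl
    · have := (Finset.mem_filter.1 hd).2
      exact hR e this.1 this.2
  refine C.row_mem_span (A := A) (fun d hd h => hZ (by rw [← h]; exact hAR d hd)) ?_ _ (by simp [A])
  intro d hd e he
  by_cases h : e ∈ Z
  · exact .inr h
  · exact .inl (by simpa [A, h] using he ▸ hAR d hd)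

/-- The Singleton bound. -/
theorem exists_errorSpace_inf_messageSpace_ne_bot (C : Code N F ω) (hω : 1 ≤ ω) {t : V}
    (ht : t ≠ N.source) (hωt : ω ≤ N.minCut t)
    (hlin : LinearIndependent F fun i : Fin ω => C.row t (.inl i)) :
    ∃ ρ : Finset E, C.errorSpace t ρ ⊓ C.messageSpace t ≠ ⊥ ∧
      ρ.card = N.redundancy ω t + 1 := by
  obtain ⟨Z, hZ, hc⟩ := N.exists_isCut_card ht
  -- A minimum cut has room for δ_t + 1 channels because ω ≥ 1.
  obtain ⟨ρ, hρZ, hρ⟩ := Finset.exists_subset_card_eq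
    (s := Z) (n := N.redundancy ω t + 1) (by rw [Network.redundancy]; omega)
  refine ⟨ρ, ?_, hρ⟩
  have hB : ∀ i : Fin ω, ∃ B : E → F, ∑ e ∈ Z, B e • C.row t (.inr e) = C.row t (.inl i) := by
    intro i
    have := C.message_mem_errorSpace hZ i
    obtain ⟨c, hc⟩ := (Submodule.mem_span_image_finset_iff_exists_fun F).1 this
    refine ⟨fun e => if h : e ∈ Z then c ⟨e, h⟩ else 0, ?_⟩
    rw [← hc, ← Finset.sum_coe_sort]
    simp
  choose B hB using hB
  -- Message rows are combinations of the rows of Z. Cancelling the part on Z \ ρ imposes only C_t -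
  -- (δ_t + 1) = ω - 1 conditions on ω unknowns.
  let L : (Fin ω → F) →ₗ[F] ((Z \ ρ : Finset E) → F) :=
    LinearMap.pi fun e => ∑ i, (B i e.1) • LinearMap.proj i
  have hL : LinearMap.ker L ≠ ⊥ := by
    apply LinearMap.ker_ne_bot_of_finrank_lt
    rw [Module.finrank_fintype_fun_eq_card, Module.finrank_fintype_fun_eq_card, Fintype.card_coe,
      Fintype.card_fin, Finset.card_sdiff_of_subset hρZ, hρ, hc, Network.redundancy]
    omega
  obtain ⟨c, hcL, hc0⟩ := Submodule.exists_mem_ne_zero_of_ne_bot hL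
  have hcB : ∀ e ∈ Z \ ρ, ∑ i, c i * B i e = 0 := by
    intro e he
    have := congrFun (LinearMap.mem_ker.1 hcL) ⟨e, he⟩
    simpa [L, mul_comm] using this
  refine (Submodule.ne_bot_iff _).2 ⟨∑ i, c i • C.row t (.inl i), ⟨?_, ?_⟩, fun h => ?_⟩
  · have : ∑ i, c i • C.row t (.inl i) = ∑ e ∈ Z, (∑ i, c i * B i e) • C.row t (.inr e) := by
      simp only [← hB, Finset.smul_sum, Finset.sum_smul, smul_smul]
      exact Finset.sum_comm
    rw [this]
    refine Submodule.sum_mem _ fun e he => ?_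
    by_cases h : e ∈ ρ
    · exact Submodule.smul_mem _ _ (Submodule.subset_span ⟨e, h, rfl⟩)
    · rw [hcB e (Finset.mem_sdiff.2 ⟨he, h⟩), zero_smul]
      exact zero_mem _
  · exact Submodule.sum_mem _ fun i _ => Submodule.smul_mem _ _ (Submodule.subset_span ⟨i, rfl⟩)
  · exact hc0 (funext fun i => Fintype.linearIndependent_iff.1 hlin c h i)

/-- A code is MDS if at each node the message rows together with the rows of each error pattern in
`R_t(δ_t)` are linearly independent. -/
theorem isMulticastMDS_of_linearIndepOn (C : Code N F ω) (hω : 1 ≤ ω)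
    (h : ∀ t, t ≠ N.source → ω ≤ N.minCut t → ∀ ρ ∈ N.rankPatterns F ω t,
      LinearIndepOn F (C.row t) ((Finset.univ.disjSum ρ : Finset (Fin ω ⊕ E)) : Set (Fin ω ⊕ E))) :
    C.IsMulticastMDS := by
  -- A smallest dominating pattern has full rank by transitivity of domination, and can then be
  -- enlarged to size δ_t keeping full rank.
  have hext : ∀ t, t ≠ N.source → ω ≤ N.minCut t → ∀ ρ : Finset E,
      N.patternRank F ω t ρ ≤ N.redundancy ω t →
      ∃ ρ' ∈ N.rankPatterns F ω t, N.Dominated F ω t ρ ρ' := by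
    intro t ht hωt ρ hρ
    obtain ⟨Z, hZ, hc⟩ := N.exists_dominated_card F ω t ρ
    have hZr : N.patternRank F ω t Z = Z.card := by
      refine (N.patternRank_le_card t Z).antisymm ?_
      obtain ⟨Y, hY, hYc⟩ := N.exists_dominated_card F ω t Z
      rw [hc, ← hYc]
      exact N.patternRank_le fun C => (hZ C).trans (hY C)
    obtain ⟨ρ', h1, h2, h3⟩ := N.exists_superset_patternRank_eq F ω ht hZr
      (n := N.redundancy ω t) (hc ▸ hρ)
      ((Nat.sub_le _ _).trans (N.minCut_le_card_inEdge ht))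
    refine ⟨ρ', by simp [Network.rankPatterns, h2, h3], fun C => (hZ C).trans ?_⟩
    exact Submodule.span_mono (Set.image_mono (by simpa using h1))
  have hlin : ∀ t, t ≠ N.source → ω ≤ N.minCut t →
      LinearIndependent F fun i : Fin ω => C.row t (.inl i) := by
    intro t ht hωt
    -- The empty pattern shows that R_t(δ_t) is nonempty; without this the hypothesis would say
    -- nothing about the message rows.
    obtain ⟨ρ, hρ, -⟩ := hext t ht hωt ∅ ((N.patternRank_le_card t ∅).trans (by simp))
    exact (h t ht hωt ρ hρ).comp
      (fun i : Fin ω => ⟨.inl i, by simp⟩) fun i j hij => by simpa using hij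
  refine ⟨fun t ht hωt => (finrank_span_eq_card (hlin t ht hωt)).trans (by simp),
    fun t ht hωt => le_antisymm ?_ ?_⟩
  · obtain ⟨ρ, h1, h2⟩ :=
      C.exists_errorSpace_inf_messageSpace_ne_bot hω ht hωt (hlin t ht hωt)
    rw [minDist_eq_card]
    exact Nat.sInf_le ⟨ρ, h1, h2⟩
  · obtain ⟨ρ₀, h₀, -⟩ :=
      C.exists_errorSpace_inf_messageSpace_ne_bot hω ht hωt (hlin t ht hωt)
    -- The Singleton pattern also serves the lower bound: the infimum of an empty set would be 0.
    refine le_csInf ⟨_, ρ₀, h₀, rfl⟩ ?_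
    rintro _ ⟨ρ, hρ, rfl⟩
    by_contra! hlt
    obtain ⟨ρ', hρ', hdom⟩ := hext t ht hωt ρ (by omega)
    refine hρ (le_bot_iff.1 ((inf_le_inf_right _ (hdom C)).trans ?_))
    have hdisj := (h t ht hωt ρ' hρ').linearIndependent.disjoint_span_image
      (s := {x | ∃ e, x.1 = .inr e}) (t := {x | ∃ i, x.1 = .inl i}) (by
        rw [Set.disjoint_left]
        rintro x ⟨e, he⟩ ⟨i, hi⟩
        simp [he] at hi)
    refine le_trans (inf_le_inf (Submodule.span_mono ?_) (Submodule.span_mono ?_)) hdisj.le_bot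
    · rintro _ ⟨e, he, rfl⟩
      exact ⟨⟨.inr e, by simpa using he⟩, ⟨e, rfl⟩, rfl⟩
    · rintro _ ⟨i, rfl⟩
      exact ⟨⟨.inl i, by simp⟩, ⟨i, rfl⟩, rfl⟩

/-- For each node `t` and pattern in `R_t(δ_t)` there is a nonzero function of the coefficients,
affine in each of them, such that the message rows together with the rows of the pattern are
linearly independent wherever it is nonzero. -/
theorem exists_affine_certificate (N : Network V E) (F : Type*) [Field F] {t : V} {ρ : Finset E}
    (ht : t ≠ N.source) (hωt : ω ≤ N.minCut t) (hρ : ρ ∈ N.rankPatterns F ω t) :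
    ∃ g : ((Fin ω ⊕ E) × E → F) → F,
      (∀ x j, ∃ α β : F, ∀ a, g (Function.update x j a) = α + a * β) ∧ (∃ x, g x ≠ 0) ∧
      ∀ C : Code N F ω, g (fun p => C.coeff p.1 p.2) ≠ 0 →
        LinearIndepOn F (C.row t)
          ((Finset.univ.disjSum ρ : Finset (Fin ω ⊕ E)) : Set (Fin ω ⊕ E)) := by
  simp only [Network.rankPatterns, Finset.mem_filter, Finset.mem_univ, true_and] at hρ
  obtain ⟨φ, hinj, hφ⟩ := N.exists_linking_disjSum F Finset.univ (hρ.2.trans hρ.1.symm) (by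
    intro _
    rw [hρ.1, Finset.card_univ, Fintype.card_fin, Network.redundancy]
    omega)
  exact ⟨N.linkingDet t φ, N.linkingDet_update t φ,
    N.exists_linkingDet_ne_zero t φ hinj fun d => (hφ d).2,
    fun C => C.linearIndepOn_row ht φ fun d => (hφ d).1⟩

end Code

end LNEC

end

/-! ### Choice of the coefficients: one certificate for each pair (t, ρ) -/

theorem mainTheorem1 {V E F : Type*} [Fintype V] [Fintype E] [Field F]
    (N : LNEC.Network V E) (ω : ℕ) (hω : 1 ≤ ω)
    (hF : ((∑ t ∈ N.decodingNodes ω, (N.rankPatterns F ω t).card : ℕ) : Cardinal) < Cardinal.mk F) :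
    ∃ C : LNEC.Code N F ω, C.IsMulticastMDS := by
  classical
  have hmem : ∀ t, t ∈ N.decodingNodes ω ↔ t ≠ N.source ∧ ω ≤ N.minCut t := by
    simp [LNEC.Network.decodingNodes]
  have hcert := fun (p : Σ _ : V, Finset E)
      (hp : p ∈ (N.decodingNodes ω).sigma fun t => N.rankPatterns F ω t) =>
    LNEC.Code.exists_affine_certificate N F ((hmem p.1).1 (Finset.mem_sigma.1 hp).1).1
      ((hmem p.1).1 (Finset.mem_sigma.1 hp).1).2 (Finset.mem_sigma.1 hp).2
  choose! g haff hne hlin using hcert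
  obtain ⟨k, hk⟩ := LNEC.exists_forall_ne_zero_of_affine
    ((N.decodingNodes ω).sigma fun t => N.rankPatterns F ω t)
    (by rwa [Finset.card_sigma]) g haff hne
  let C : LNEC.Code N F ω := ⟨fun d e => k (d, e)⟩
  refine ⟨C, C.isMulticastMDS_of_linearIndepOn hω fun t ht hωt ρ hρ => ?_⟩
  have hp : (⟨t, ρ⟩ : Σ _ : V, Finset E) ∈
      (N.decodingNodes ω).sigma fun t => N.rankPatterns F ω t :=
    Finset.mem_sigma.2 ⟨(hmem t).2 ⟨ht, hωt⟩, hρ⟩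
  exact hlin _ hp C (hk _ hp)
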